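/- Let $n,k\in\mathbb{N}$. An $n$-resource/$k$-player-type \emph{resource selection game with I.D.-dependent weighting} $G$ consists of: for every resource $j\in[n]$, a nondecreasing cost function $f_j:\mathbb{R}_{\ge 0}\to\mathbb{R}$; for every player type $i\in[k]$, a nonempty set $R^i\subseteq[n]$ of resources that are legal for type $i$; and, for all $i\in[k]$ and $j\in R^i$, an increasing (not necessarily strictly increasing) weighting function $f^i_j:[0,1]\to\mathbb{R}_{\ge 0}$. No continuity is assumed. A \emph{consumption profile} assigns to every $i\in[k]$ a vector $s(i)\in[0,1]^{[n]}$ with $\sum_{j\in R^i}s_j(i)=1$ and $s_j(i)=0$ for $j\notin R^i$. Under $s$, the (weighted) \emph{load} on resource $j$ is $\ell^s_j=\sum_{i:\,j\in R^i}f^i_j(s_j(i))$ and its \emph{cost} is $h^s_j=f_j(\ell^s_j)$. Write $\operatorname{supp}(s(i))=\{j: s_j(i)\neq 0\}$. A profile $s$ is a \emph{Nash equilibrium} if $h^s_l\le h^s_j$ for all $i\in[k]$, $l\in\operatorname{supp}(s(i))$ and $j\in R^i$; in this case let $h^i$ denote the common value of $h^s_j$ over all $j\in\operatorname{supp}(s(i))$.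 A Nash equilibrium $s$ is a \emph{strong Nash equilibrium} if there is no consumption profile $s'\neq s$ such that $h^{s'}_l<h^i$ for all $i\in[k]$ and $l\in\operatorname{supp}(s'(i))$ with $s'_l(i)>s_l(i)$. \textbf{Corollary.} Let $G$ be a resource selection game with I.D.-dependent weighting. (1) (Players are indifferent between strong equilibria.) $h^s_l=h^{s'}_{l'}$ for every two strong Nash equilibria $s,s'$ of $G$, every player type $i\in[k]$, every $l\in\operatorname{supp}(s(i))$ and every $l'\in\operatorname{supp}(s'(i))$. (2) (Uniqueness of strong equilibrium resource loads.) If all of $f_1,\dots,f_n$ are strictly increasing, then $\ell^s_j=\ell^{s'}_j$ for every resource $j\in[n]$ and every two strong Nash equilibria $s,s'$ of $G$. -/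

import Mathlib

open scoped NNReal unitInterval

/-- The simplex `Δ^R` on a set `R` of coordinates, as a subset of `[0,1]^[n]`. -/
def coordSimplex {n : ℕ} (R : Finset (Fin n)) : Set (Fin n → I) :=
  {x | ∑ j ∈ R, (x j : ℝ) = 1 ∧ ∀ j, j ∉ R → x j = 0}

/-- The support of a vector of consumption fractions. -/
def consSupport {n : ℕ} (x : Fin n → I) : Set (Fin n) := {j | x j ≠ 0}

/-- An `n`-resource/`k`-player-type resource selection game with I.D.-dependent weighting.
Neither the cost functions nor the weighting functions are required to be continuous. -/
structure IDWeightedGame (n k : ℕ) where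
  /-- `resCost j` maps the (weighted) load on resource `j` to the cost of that resource. -/
  resCost : Fin n → ℝ≥0 → ℝ
  resCost_mono : ∀ j, Monotone (resCost j)
  /-- `legal i` is the set of resources from which type `i` may consume. -/
  legal : Fin k → Finset (Fin n)
  legal_nonempty : ∀ i, (legal i).Nonempty
  /-- `weight i j` is the weighting of the consumption of type `i` from a legal resource `j`. -/
  weight : ∀ (i : Fin k) (j : Fin n), j ∈ legal i → I → ℝ≥0
  /-- Increasing in the weak sense; strictly increasing weightings are a special case. -/
  weight_mono : ∀ (i : Fin k) (j : Fin n) (hj : j ∈ legal i), Monotone (weight i j hj)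

namespace IDWeightedGame

variable {n k : ℕ} (G : IDWeightedGame n k)

/-- `s` is a consumption profile: `s i j` is the fraction of the players of type `i` who
consume from resource `j`. -/
def IsProfile (s : Fin k → Fin n → I) : Prop :=
  ∀ i, s i ∈ coordSimplex (G.legal i)

/-- The weighted load on resource `j`: the sum over all types `i` for which `j` is legal. -/
def load (s : Fin k → Fin n → I) (j : Fin n) : ℝ≥0 :=
  ∑ i : Fin k, if hj : j ∈ G.legal i then G.weight i j hj (s i j) else 0

/-- The cost of resource `j` under the profile `s`. -/
def cost (s : Fin k → Fin n → I) (j : Fin n) : ℝ :=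
  G.resCost j (G.load s j)

/-- Nash equilibrium. -/
def IsNash (s : Fin k → Fin n → I) : Prop :=
  G.IsProfile s ∧
    ∀ i, ∀ l ∈ consSupport (s i), ∀ j ∈ G.legal i, G.cost s l ≤ G.cost s j

/-- Strong Nash equilibrium: a Nash equilibrium from which no group of players can deviate so that
all deviators gain. In a Nash equilibrium `s` the support of `s i` is nonempty and all its members
have the same cost, which is the cost paid by type `i`; so the last inequality says that every
player of type `i` who moves to `l` pays there less than type `i` pays under `s`. -/
def IsStrongNash (s : Fin k → Fin n → I) : Prop :=
  G.IsNash s ∧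
    ¬ ∃ s' : Fin k → Fin n → I, G.IsProfile s' ∧ s' ≠ s ∧
      ∀ i, ∀ l ∈ consSupport (s' i), s i l < s' i l →
        ∀ j ∈ consSupport (s i), G.cost s' l < G.cost s j

end IDWeightedGame

namespace IDWeightedGame

variable {n k : ℕ} {G : IDWeightedGame n k} {s s' : Fin k → Fin n → I}

/-! Everything rests on `IsStrongNash.cost_le`. Let the types that pay less in `s'` switch to `s'`
while the rest keep `s`. No other type uses under `s` a resource that a switcher uses under `s'`, so
the costs there do not exceed those under `s'` and every switcher gains. By symmetry, two strong
equilibria give each type the same cost. -/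

theorem IsProfile.mem_legal (hs : G.IsProfile s) {i : Fin k} {j : Fin n}
    (hj : j ∈ consSupport (s i)) : j ∈ G.legal i := by
  by_contra h
  exact hj ((hs i).2 j h)

theorem IsProfile.consSupport_nonempty (hs : G.IsProfile s) (i : Fin k) :
    (consSupport (s i)).Nonempty := by
  by_contra h
  have h0 : ∀ j, s i j = 0 := fun j => by
    by_contra hj
    exact h ⟨j, hj⟩
  have h1 := (hs i).1
  simp [h0] at h1

theorem IsNash.cost_eq (hs : G.IsNash s) {i : Fin k} {l l' : Fin n}
    (hl : l ∈ consSupport (s i)) (hl' : l' ∈ consSupport (s i)) : G.cost s l = G.cost s l' :=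
  le_antisymm (hs.2 i l hl l' (hs.1.mem_legal hl')) (hs.2 i l' hl' l (hs.1.mem_legal hl))

/-- The load on a resource is monotone in the consumption of the types for which it is legal. -/
theorem load_le_load {j : Fin n} (h : ∀ i, j ∈ G.legal i → s i j ≤ s' i j) :
    G.load s j ≤ G.load s' j := by
  refine Finset.sum_le_sum fun i _ => ?_
  split_ifs with hj
  · exact G.weight_mono i j hj (h i hj)
  · exact le_rfl

theorem cost_le_cost {j : Fin n} (h : ∀ i, j ∈ G.legal i → s i j ≤ s' i j) :
    G.cost s j ≤ G.cost s' j :=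
  G.resCost_mono j (load_le_load h)

/-- No type pays less in a Nash equilibrium than in a strong Nash equilibrium: otherwise all types
that pay less could jointly deviate to their strategies in the former. -/
theorem IsStrongNash.cost_le (hs : G.IsStrongNash s) (hs' : G.IsNash s') {i : Fin k} {l l' : Fin n}
    (hl : l ∈ consSupport (s i)) (hl' : l' ∈ consSupport (s' i)) :
    G.cost s l ≤ G.cost s' l' := by
  classical
  by_contra! hlt
  let gains : Fin k → Prop := fun i =>
    ∀ l ∈ consSupport (s i), ∀ l' ∈ consSupport (s' i), G.cost s' l' < G.cost s l
  let t : Fin k → Fin n → I := fun i => if gains i then s' i else s i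
  have ht : G.IsProfile t := fun i => by
    by_cases h : gains i
    · simpa [t, h] using hs'.1 i
    · simpa [t, h] using hs.1.1 i
  have hcost : ∀ i, gains i → ∀ m ∈ consSupport (s' i), G.cost t m ≤ G.cost s' m := by
    intro i hi m hm
    refine cost_le_cost fun a _ => ?_
    by_cases ha : gains a
    · simp [t, ha]
    · by_cases h0 : s a m = 0
      · simp [t, ha, h0]
      -- A non-gaining type `a` on `m` would give `cost s' m < cost s p ≤ cost s m = cost s q ≤ cost
      -- s' q' ≤ cost s' m`.
      · exfalso
        obtain ⟨p, hp⟩ := hs.1.1.consSupport_nonempty i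
        simp only [gains, not_forall, not_lt] at ha
        obtain ⟨q, hq, q', hq', hle⟩ := ha
        have h1 := hi p hp m hm
        have h2 := hs.1.2 i p hp m (hs'.1.mem_legal hm)
        have h3 := hs.1.cost_eq (i := a) (l := m) h0 hq
        have h4 := hs'.2 a q' hq' m (hs.1.1.mem_legal (i := a) h0)
        linarith
  have hi : gains i := fun p hp q hq => by
    rwa [hs.1.cost_eq hp hl, hs'.cost_eq hq hl']
  refine hs.2 ⟨t, ht, fun h => ?_, fun a m hm hsm j hj => ?_⟩
  -- If `t = s`, then `l'` costs under `s` at most its cost under `s'`, so type `i` would gain by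
  -- moving to `l'` in the Nash equilibrium `s`.
  · have h1 := hcost i hi l' hl'
    rw [h] at h1
    have h2 := hs.1.2 i l hl l' (hs'.1.mem_legal hl')
    linarith
  · by_cases ha : gains a
    · have hm' : m ∈ consSupport (s' a) := by simpa [t, ha] using hm
      exact (hcost a ha m hm').trans_lt (ha j hj m hm')
    · simp [t, ha] at hsm

theorem IsStrongNash.cost_eq (hs : G.IsStrongNash s) (hs' : G.IsStrongNash s') {i : Fin k}
    {l l' : Fin n} (hl : l ∈ consSupport (s i)) (hl' : l' ∈ consSupport (s' i)) :
    G.cost s l = G.cost s' l' :=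
  le_antisymm (hs.cost_le hs'.1 hl hl') (hs'.cost_le hs.1 hl' hl)

/-- A larger load on `j` under `s` needs a type consuming more of `j` there. That type pays the cost
of `j` under `s`, and its equal or larger cost under `s'` is at most that of `j`, against strict
monotonicity. -/
theorem IsStrongNash.load_le (hG : ∀ j, StrictMono (G.resCost j)) (hs : G.IsStrongNash s)
    (hs' : G.IsStrongNash s') (j : Fin n) : G.load s j ≤ G.load s' j := by
  by_contra! hlt
  obtain ⟨i, hj, hi⟩ : ∃ i, j ∈ G.legal i ∧ s' i j < s i j := by
    by_contra! h
    exact hlt.not_ge (load_le_load h)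
  have hij : j ∈ consSupport (s i) := (hi.trans_le' (s' i j).2.1).ne'
  obtain ⟨p, hp⟩ := hs'.1.1.consSupport_nonempty i
  have hle : G.cost s j ≤ G.cost s' j := (hs.cost_le hs'.1 hij hp).trans (hs'.1.2 i p hp j hj)
  exact hle.not_gt (hG j hlt)

end IDWeightedGame

theorem mainTheorem7 {n k : ℕ} (G : IDWeightedGame n k) :
    (∀ s s' : Fin k → Fin n → unitInterval, G.IsStrongNash s → G.IsStrongNash s' →
      ∀ i : Fin k, ∀ l ∈ consSupport (s i), ∀ l' ∈ consSupport (s' i),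
        G.cost s l = G.cost s' l') ∧
    ((∀ j : Fin n, StrictMono (G.resCost j)) →
      ∀ s s' : Fin k → Fin n → unitInterval, G.IsStrongNash s → G.IsStrongNash s' →
        ∀ j : Fin n, G.load s j = G.load s' j) :=
  ⟨fun _ _ hs hs' _ _ hl _ hl' => hs.cost_eq hs' hl hl',
    fun hG _ _ hs hs' j => le_antisymm (hs.load_le hG hs' j) (hs'.load_le hG hs j)⟩
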